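/- Let $(\Omega,\mathcal F,P)$ be a probability space and write $L^1$ for the integrable random variables on it. For $\alpha\in(0,1)$ and $X\in L^1$ put $$\mathrm{V@R}_\alpha(X)=\inf\{x\in\mathbb R : P(X+x<0)\le\alpha\},\qquad \mathrm{AV@R}_\alpha(X)=\frac1\alpha\int_0^\alpha \mathrm{V@R}_\beta(X)\,d\beta ,$$ and for an increasing $\gamma:[0,1]\to(0,1)$ and $X,Y\in L^1$ put $$\mathrm{ReAV@R}_\gamma(X,Y)=\sup_{\lambda\in[0,1]}\mathrm{AV@R}_{\gamma(\lambda)}(X+(1-\lambda)Y)\in\mathbb R\cup\{\infty\}.$$ Let $\gamma$ be the step function with $\gamma=\alpha_k$ on $[r_{k-1},r_k)$ for $k=1,\dots,n$ and $\gamma=\alpha_{n+1}$ on $[r_n,1]$, where $0<\alpha_1<\dots<\alpha_{n+1}<1$ and $0=r_0<r_1<\dots<r_n<r_{n+1}=1$. A firm consists of $N\ge1$ subentities. Subentity $i$ has a deterministic net asset value $E^i_0\in\mathbb R$ at time $0$ and, at time $1$, a net asset value $E_1^i\in L^1$ and liabilities $L^i_1\in L^1$ with $L^i_1\ge0$ almost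 surely. Write $\Delta E^i_1=E^i_1-E^i_0$, $E_1=\sum_iE_1^i$, $L_1=\sum_iL^i_1$, $\Delta E_1=\sum_i\Delta E^i_1$. Let $j\in\{1,\dots,n+1\}$ satisfy $$\mathrm{AV@R}_{\alpha_j}(\Delta E_1+(1-r_j)L_1)>\mathrm{AV@R}_{\alpha_k}(\Delta E_1+(1-r_k)L_1)\qquad\text{for all } k\in\{1,\dots,n+1\},\ k\ne j.$$ Assume that $X^i=-(\Delta E^i_1+(1-r_j)L^i_1)$, $i=1,\dots,N$, satisfy Assumption (S) at level $\alpha_j$: * $X^1,\dots,X^N$ are integrable and have continuous distributions; * the conditional distribution of $X^1$ given $(X^2,\dots,X^N)$ has a (jointly measurable, nonnegative) density $\phi(\cdot,X^2,\dots,X^N)$, and $x^1\mapsto\phi(x^1,x^2,\dots,x^N)$ is continuous for all $x^2,\dots,x^N\in\mathbb R$; * the maps $(x,u)\mapsto E[\phi(u_1^{-1}(x-\sum_{i=2}^Nu_iX^i),X^2,\dots,X^N)]$ and $(x,u)\mapsto E[X^l\phi(u_1^{-1}(x-\sum_{i=2}^Nu_iX^i),X^2,\dots,X^N)]$, $l=2,\dots,N$,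 are finite valued and continuous on $\mathbb R\times(\mathbb R\setminus\{0\})\times\mathbb R^{N-1}$; * for every $u\in(\mathbb R\setminus\{0\})\times\mathbb R^{N-1}$, $E[\phi(u_1^{-1}(q(u)-\sum_{i=2}^Nu_iX^i),X^2,\dots,X^N)]>0$, where $q(u)=\inf\{x\in\mathbb R: P(\sum_{i=1}^Nu_iX^i\le x)\ge1-\alpha_j\}$. Then the Euler allocation for $\mathrm{ReAV@R}_\gamma$, $$\kappa^i=\frac{d}{dh}\,\mathrm{ReAV@R}_\gamma(\Delta E_1+h\,\Delta E^i_1,\;L_1+h\,L^i_1)\Big|_{h=0},\qquad i=1,\dots,N,$$ exists (the function of $h$ is finite near $0$ and differentiable at $0$), and for every $i$ $$\kappa^i=-E\big[\Delta E^i_1+(1-r_j)L^i_1\,\big|\,E_1+(1-r_j)L_1\le-\mathrm{V@R}_{\alpha_j}(E_1+(1-r_j)L_1)\big].$$ -/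

import Mathlib

open MeasureTheory ProbabilityTheory Filter Topology

namespace RecoveryRisk

noncomputable section

/-- Value at Risk at level `a` (positive values of `X` are gains):
the smallest amount `x` of cash with `P (X + x < 0) ≤ a`. -/
def var {Ω : Type*} [MeasurableSpace Ω] (P : Measure Ω) (a : ℝ) (X : Ω → ℝ) : ℝ :=
  sInf {x : ℝ | P.real {ω | X ω + x < 0} ≤ a}

/-- Average Value at Risk at level `a`. -/
def avar {Ω : Type*} [MeasurableSpace Ω] (P : Measure Ω) (a : ℝ) (X : Ω → ℝ) : ℝ :=
  (1 / a) * ∫ b in (0 : ℝ)..a, var P b X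

/-- Recovery Average Value at Risk with level function `γ`; the supremum over the recovery
fractions is taken in the extended reals. -/
def reavar {Ω : Type*} [MeasurableSpace Ω] (P : Measure Ω) (γ : Set.Icc (0 : ℝ) 1 → ℝ)
    (X Y : Ω → ℝ) : EReal :=
  ⨆ l : Set.Icc (0 : ℝ) 1,
    ((avar P (γ l) (fun ω => X ω + (1 - (l : ℝ)) * Y ω) : ℝ) : EReal)

/-- `γ` is the step function with levels `0 < α₁ < ⋯ < αₙ₊₁ < 1` and nodes
`0 = r₀ < r₁ < ⋯ < rₙ < rₙ₊₁ = 1`: it equals `αₖ` on `[rₖ₋₁, rₖ)`, and `αₙ₊₁` also at `1`.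
The level `αₖ` is `α (k - 1)` and the node `rₖ` is `r k`; so the level `α k` (for
`k : Fin (n + 1)`) lives between the nodes `r k.castSucc` and `r k.succ`. -/
structure IsStepLevel {n : ℕ} (α : Fin (n + 1) → ℝ) (r : Fin (n + 2) → ℝ)
    (γ : Set.Icc (0 : ℝ) 1 → ℝ) : Prop where
  level_strictMono : StrictMono α
  level_pos : 0 < α 0
  level_lt_one : α (Fin.last n) < 1
  node_strictMono : StrictMono r
  node_zero : r 0 = 0
  node_last : r (Fin.last (n + 1)) = 1
  eq_level : ∀ (k : Fin (n + 1)) (l : Set.Icc (0 : ℝ) 1),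
    r k.castSucc ≤ (l : ℝ) → (l : ℝ) < r k.succ → γ l = α k
  eq_level_one : ∀ l : Set.Icc (0 : ℝ) 1, (l : ℝ) = 1 → γ l = α (Fin.last n)

/-- The random variable `φ (u₁⁻¹ (x - ∑_{i ≥ 2} uᵢ Xⁱ), X², …, Xᴺ)`, where `N = m + 1` and
the index `0` plays the role of `1`. -/
def densityAt {Ω : Type*} {m : ℕ} (X : Fin (m + 1) → Ω → ℝ) (φ : ℝ → (Fin m → ℝ) → ℝ)
    (x : ℝ) (u : Fin (m + 1) → ℝ) (ω : Ω) : ℝ :=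
  φ ((u 0)⁻¹ * (x - ∑ i : Fin m, u i.succ * X i.succ ω)) (fun i => X i.succ ω)

/-- The (lower) `(1 - a)`-quantile of `∑ uᵢ Xⁱ`. -/
def lossQuantile {Ω : Type*} [MeasurableSpace Ω] (P : Measure Ω) {m : ℕ} (a : ℝ)
    (X : Fin (m + 1) → Ω → ℝ) (u : Fin (m + 1) → ℝ) : ℝ :=
  sInf {x : ℝ | 1 - a ≤ P.real {ω | ∑ i, u i * X i ω ≤ x}}

/-- Tasche's Assumption (S) at level `a` for the random vector `(X¹, …, Xᴺ)`, `N = m + 1`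
(the index `0` plays the role of `1`). -/
structure AssumptionSWith {Ω : Type*} [MeasurableSpace Ω] (P : Measure Ω) [IsFiniteMeasure P]
    {m : ℕ} (a : ℝ) (X : Fin (m + 1) → Ω → ℝ) (φ : ℝ → (Fin m → ℝ) → ℝ) : Prop where
  integrable : ∀ i, Integrable (X i) P
  /-- each `Xⁱ` has a continuous distribution -/
  continuous_distribution : ∀ i x, P {ω | X i ω = x} = 0
  density_measurable : Measurable (Function.uncurry φ)
  density_nonneg : ∀ t y, 0 ≤ φ t y
  /-- the conditional distribution of `X¹` given `X², …, Xᴺ` has density `φ` -/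
  cond_density : ∀ᵐ y ∂(P.map (fun ω (i : Fin m) => X i.succ ω)),
    condDistrib (X 0) (fun ω (i : Fin m) => X i.succ ω) P y
      = volume.withDensity (fun t => ENNReal.ofReal (φ t y))
  density_continuous : ∀ y, Continuous (fun t => φ t y)
  /-- `(x, u) ↦ E[φ(…)]` is finite valued -/
  finite_one : ∀ (x : ℝ) (u : Fin (m + 1) → ℝ), u 0 ≠ 0 → Integrable (densityAt X φ x u) P
  /-- `(x, u) ↦ E[φ(…)]` is continuous -/
  continuous_one : ContinuousOn
    (fun p : ℝ × (Fin (m + 1) → ℝ) => ∫ ω, densityAt X φ p.1 p.2 ω ∂P) {p | p.2 0 ≠ 0}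
  /-- `(x, u) ↦ E[Xˡ φ(…)]` is finite valued, `l = 2, …, N` -/
  finite_mul : ∀ (l : Fin m) (x : ℝ) (u : Fin (m + 1) → ℝ), u 0 ≠ 0 →
    Integrable (fun ω => X l.succ ω * densityAt X φ x u ω) P
  /-- `(x, u) ↦ E[Xˡ φ(…)]` is continuous, `l = 2, …, N` -/
  continuous_mul : ∀ l : Fin m, ContinuousOn
    (fun p : ℝ × (Fin (m + 1) → ℝ) => ∫ ω, X l.succ ω * densityAt X φ p.1 p.2 ω ∂P)
    {p | p.2 0 ≠ 0}
  /-- `E[φ(…)]` is positive at the quantile -/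
  pos_at_quantile : ∀ u : Fin (m + 1) → ℝ, u 0 ≠ 0 →
    0 < ∫ ω, densityAt X φ (lossQuantile P a X u) u ω ∂P

/-- Assumption (S) at level `a`: some conditional density has the required properties. -/
def AssumptionS {Ω : Type*} [MeasurableSpace Ω] (P : Measure Ω) [IsFiniteMeasure P]
    {m : ℕ} (a : ℝ) (X : Fin (m + 1) → Ω → ℝ) : Prop :=
  ∃ φ : ℝ → (Fin m → ℝ) → ℝ, AssumptionSWith P a X φ

/-- `κ` is the Euler allocation for the functional `ρ` of pairs and the positions
`(Xⁱ, Yⁱ)`: with `X = ∑ Xⁱ` and `Y = ∑ Yⁱ`, the function `h ↦ ρ (X + h Xⁱ, Y + h Yⁱ)` is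
finite near `h = 0` and differentiable at `h = 0` with derivative `κⁱ`. -/
def IsEulerAllocation {Ω ι : Type*} [Fintype ι] (ρ : (Ω → ℝ) → (Ω → ℝ) → EReal)
    (X Y : ι → Ω → ℝ) (κ : ι → ℝ) : Prop :=
  ∀ i,
    (∀ᶠ h : ℝ in 𝓝 0,
      ρ (fun ω => (∑ k, X k ω) + h * X i ω) (fun ω => (∑ k, Y k ω) + h * Y i ω) ≠ ⊤ ∧
      ρ (fun ω => (∑ k, X k ω) + h * X i ω) (fun ω => (∑ k, Y k ω) + h * Y i ω) ≠ ⊥) ∧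
    HasDerivAt (fun h : ℝ =>
      (ρ (fun ω => (∑ k, X k ω) + h * X i ω) (fun ω => (∑ k, Y k ω) + h * Y i ω)).toReal) (κ i) 0

end

end RecoveryRisk

/-! On step `k` the level is constant, and since the liabilities are nonnegative AV@R decreases as
the recovery fraction grows away from its right node. AV@R is `L¹`-Lipschitz, so the supremum over
the step is the limit at that node (`IsStepLevel.reavar_eq`): ReAV@R is a maximum of finitely many
AV@Rs. The strict maximum at `j` persists for small `h` by continuity, so near `h = 0` the function
is a single AV@R along a line.

Its derivative comes from a squeeze (`hasDerivAt_avar`). The Rockafellar–Uryasev bound with the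
threshold frozen at the V@R of the base position lies above AV@R; the mean loss over the frozen tail
event lies below. Both are exact at `h = 0`, and without an atom at the V@R they have the same
derivative, the mean loss of the direction on the tail event. From Assumption (S), only
integrability and the conditional density are used, to exclude atoms
(`AssumptionSWith.measure_sum_eq_zero`). Finally, cash additivity lets `E₁` replace `ΔE₁` in the
conditioning event. -/

namespace RecoveryRisk

/-- The upper tail quantile of a law: the smallest `x` with `μ (x, ∞) ≤ b`. -/
noncomputable def tailQuantile (μ : Measure ℝ) (b : ℝ) : ℝ :=
  sInf {x : ℝ | μ.real (Set.Ioi x) ≤ b}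

/-! ### Quantile transform and the Rockafellar–Uryasev formula for a law on the line. -/

section TailQuantile

variable {μ : Measure ℝ} [IsProbabilityMeasure μ] {a b : ℝ}

lemma real_Ioi_eq_one_sub_cdf (μ : Measure ℝ) [IsProbabilityMeasure μ] (x : ℝ) :
    μ.real (Set.Ioi x) = 1 - cdf μ x := by
  rw [cdf_eq_real, ← Set.compl_Iic, probReal_compl_eq_one_sub measurableSet_Iic]

lemma bddBelow_tail_le (hb : b < 1) : BddBelow {x : ℝ | μ.real (Set.Ioi x) ≤ b} := by
  have h := (tendsto_cdf_atBot μ).eventually_lt_const (sub_pos.2 hb)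
  obtain ⟨y, hy⟩ := h.exists
  refine ⟨y, fun x hx => ?_⟩
  by_contra hlt
  have := (cdf μ).mono (not_le.1 hlt).le
  simp only [Set.mem_ofPred_eq, real_Ioi_eq_one_sub_cdf] at hx
  linarith

lemma nonempty_tail_le (hb : 0 < b) : {x : ℝ | μ.real (Set.Ioi x) ≤ b}.Nonempty := by
  have h := (tendsto_cdf_atTop μ).eventually_const_lt (show 1 - b < 1 by linarith)
  obtain ⟨y, hy⟩ := h.exists
  refine ⟨y, ?_⟩
  simp only [Set.mem_ofPred_eq, real_Ioi_eq_one_sub_cdf]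
  linarith

/-- Right-continuity of the cdf makes the infimum attained. All later facts about quantiles go
through this equivalence. -/
lemma tailQuantile_le_iff (hb0 : 0 < b) (hb1 : b < 1) (x : ℝ) :
    tailQuantile μ b ≤ x ↔ μ.real (Set.Ioi x) ≤ b := by
  refine ⟨fun h => ?_, fun h => csInf_le (bddBelow_tail_le hb1) h⟩
  have hgt : ∀ y ∈ Set.Ioi x, 1 - b ≤ cdf μ y := by
    intro y hy
    obtain ⟨z, hz, hzy⟩ := (csInf_lt_iff (bddBelow_tail_le hb1) (nonempty_tail_le hb0)).1
      (lt_of_le_of_lt h hy)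
    have := (cdf μ).mono hzy.le
    simp only [Set.mem_ofPred_eq, real_Ioi_eq_one_sub_cdf] at hz
    linarith
  have hlim : Tendsto (cdf μ) (𝓝[>] x) (𝓝 (cdf μ x)) :=
    ((cdf μ).right_continuous x).mono_left (nhdsWithin_mono x Set.Ioi_subset_Ici_self)
  have := ge_of_tendsto hlim (eventually_nhdsWithin_of_forall hgt)
  rw [real_Ioi_eq_one_sub_cdf]
  linarith

lemma antitoneOn_tailQuantile : AntitoneOn (tailQuantile μ) (Set.Ioo 0 1) := by
  intro b hb c hc hbc
  rw [tailQuantile_le_iff hc.1 hc.2]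
  exact ((tailQuantile_le_iff hb.1 hb.2 _).1 le_rfl).trans hbc

lemma aemeasurable_tailQuantile :
    AEMeasurable (tailQuantile μ) (volume.restrict (Set.Ioo (0 : ℝ) 1)) :=
  aemeasurable_restrict_of_antitoneOn measurableSet_Ioo antitoneOn_tailQuantile

/-- Under Lebesgue measure on `(0, 1)`, the tail quantile function has law `μ`. -/
lemma map_tailQuantile :
    (volume.restrict (Set.Ioo (0 : ℝ) 1)).map (tailQuantile μ) = μ := by
  symm
  refine Measure.ext_of_Iic _ _ fun x => ?_
  rw [Measure.map_apply_of_aemeasurable aemeasurable_tailQuantile measurableSet_Iic,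
    Measure.restrict_apply₀ (aemeasurable_tailQuantile.nullMeasurableSet_preimage
      measurableSet_Iic)]
  have hset : tailQuantile μ ⁻¹' Set.Iic x ∩ Set.Ioo 0 1
      = Set.Ici (1 - cdf μ x) ∩ Set.Ioo 0 1 := by
    ext b
    simp only [Set.mem_inter_iff, Set.mem_preimage, Set.mem_Iic, Set.mem_Ici]
    refine and_congr_left fun hb => ?_
    rw [tailQuantile_le_iff hb.1 hb.2, real_Ioi_eq_one_sub_cdf]
  have h0 : 0 ≤ 1 - cdf μ x := sub_nonneg.2 (cdf_le_one μ x)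
  -- The endpoints are null, and `0 ≤ 1 - cdf μ x` makes the constraint `0 < b` redundant.
  have hae : (Set.Ici (1 - cdf μ x) ∩ Set.Ioo 0 1 : Set ℝ)
      =ᵐ[volume] Set.Ioc (1 - cdf μ x) 1 := by
    have h1 : (Set.Ici (1 - cdf μ x) ∩ Set.Ioo 0 1 : Set ℝ)
        =ᵐ[volume] (Set.Ioi (1 - cdf μ x) ∩ Set.Ioc 0 1 : Set ℝ) :=
      Ioi_ae_eq_Ici.symm.inter Ioo_ae_eq_Ioc
    refine h1.trans (Eventually.of_forall fun b => ?_)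
    simp only [eq_iff_iff]
    change (b ∈ Set.Ioi (1 - cdf μ x) ∩ Set.Ioc 0 1) ↔ b ∈ Set.Ioc (1 - cdf μ x) 1
    simp only [Set.mem_inter_iff, Set.mem_Ioi, Set.mem_Ioc]
    exact ⟨fun h => ⟨h.1, h.2.2⟩, fun h => ⟨h.1, h0.trans_lt h.1, h.2⟩⟩
  rw [hset, measure_congr hae, Real.volume_Ioc, sub_sub_cancel, cdf_eq_real,
    ofReal_measureReal]

lemma integrableOn_tailQuantile (hμ : Integrable id μ) :
    IntegrableOn (tailQuantile μ) (Set.Ioo (0 : ℝ) 1) := by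
  have h : Integrable id ((volume.restrict (Set.Ioo (0 : ℝ) 1)).map (tailQuantile μ)) := by
    rwa [map_tailQuantile]
  exact h.comp_aemeasurable aemeasurable_tailQuantile

lemma setIntegral_posPart_tailQuantile (x : ℝ) :
    ∫ b in Set.Ioo (0 : ℝ) 1, max (tailQuantile μ b - x) 0 = ∫ t, max (t - x) 0 ∂μ := by
  conv_rhs => rw [← map_tailQuantile (μ := μ)]
  rw [integral_map aemeasurable_tailQuantile]
  exact (by fun_prop : Continuous fun t : ℝ => max (t - x) 0).aestronglyMeasurable

lemma intervalIntegrable_tailQuantile (hμ : Integrable id μ) (ha0 : 0 < a) (ha1 : a < 1) :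
    IntervalIntegrable (tailQuantile μ) volume 0 a := by
  rw [intervalIntegrable_iff_integrableOn_Ioo_of_le ha0.le]
  exact (integrableOn_tailQuantile hμ).mono_set (Set.Ioo_subset_Ioo_right ha1.le)

lemma integral_tailQuantile_sub (hμ : Integrable id μ) (ha0 : 0 < a) (ha1 : a < 1) (x : ℝ) :
    ∫ b in (0 : ℝ)..a, (tailQuantile μ b - x) = (∫ b in (0 : ℝ)..a, tailQuantile μ b) - a * x := by
  rw [intervalIntegral.integral_sub (intervalIntegrable_tailQuantile hμ ha0 ha1)
    intervalIntegrable_const]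
  simp

/-- The Rockafellar–Uryasev bound for the integrated tail quantile. -/
lemma integral_tailQuantile_le (hμ : Integrable id μ) (ha0 : 0 < a) (ha1 : a < 1) (x : ℝ) :
    ∫ b in (0 : ℝ)..a, tailQuantile μ b ≤ a * x + ∫ t, max (t - x) 0 ∂μ := by
  have hint : IntegrableOn (fun b => max (tailQuantile μ b - x) 0) (Set.Ioo (0 : ℝ) 1) :=
    ((integrableOn_tailQuantile hμ).sub (integrable_const x)).pos_part
  have hsub : Set.Ioo 0 a ⊆ Set.Ioo (0 : ℝ) 1 := Set.Ioo_subset_Ioo_right ha1.le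
  have h1 := integral_tailQuantile_sub hμ ha0 ha1 x
  rw [intervalIntegral.integral_of_le ha0.le, integral_Ioc_eq_integral_Ioo] at h1
  have h2 : ∫ b in Set.Ioo 0 a, (tailQuantile μ b - x)
      ≤ ∫ b in Set.Ioo 0 a, max (tailQuantile μ b - x) 0 :=
    integral_mono (((integrableOn_tailQuantile hμ).mono_set hsub).sub (integrable_const x))
      (hint.mono_set hsub) fun b => le_max_left _ _
  have h3 : ∫ b in Set.Ioo 0 a, max (tailQuantile μ b - x) 0
      ≤ ∫ b in Set.Ioo 0 1, max (tailQuantile μ b - x) 0 :=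
    setIntegral_mono_set hint (Eventually.of_forall fun b => le_max_right _ _)
      hsub.eventuallyLE
  rw [setIntegral_posPart_tailQuantile] at h3
  linarith

/-- The Rockafellar–Uryasev bound is attained at the tail quantile. -/
lemma integral_tailQuantile_eq (hμ : Integrable id μ) (ha0 : 0 < a) (ha1 : a < 1) :
    ∫ b in (0 : ℝ)..a, tailQuantile μ b
      = a * tailQuantile μ a + ∫ t, max (t - tailQuantile μ a) 0 ∂μ := by
  set x := tailQuantile μ a with hx
  have hsub : Set.Ioo 0 a ⊆ Set.Ioo (0 : ℝ) 1 := Set.Ioo_subset_Ioo_right ha1.le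
  have h1 := integral_tailQuantile_sub hμ ha0 ha1 x
  rw [intervalIntegral.integral_of_le ha0.le, integral_Ioc_eq_integral_Ioo] at h1
  -- As `x` is the quantile at `a`, monotonicity makes the excess over `x` nonnegative for levels
  -- below `a` and nonpositive above, so both inequalities of the bound become equalities.
  have h2 : ∫ b in Set.Ioo 0 a, (tailQuantile μ b - x)
      = ∫ b in Set.Ioo 0 a, max (tailQuantile μ b - x) 0 :=
    setIntegral_congr_fun measurableSet_Ioo fun b hb =>
      (max_eq_left (sub_nonneg.2 (antitoneOn_tailQuantile (hsub hb) ⟨ha0, ha1⟩ hb.2.le))).symm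
  have h3 : ∫ b in Set.Ioo 0 1, max (tailQuantile μ b - x) 0
      = ∫ b in Set.Ioo 0 a, max (tailQuantile μ b - x) 0 :=
    setIntegral_eq_of_subset_of_forall_sdiff_eq_zero measurableSet_Ioo hsub fun b hb =>
      max_eq_right (sub_nonpos.2 (antitoneOn_tailQuantile ⟨ha0, ha1⟩ hb.1
        (not_lt.1 fun h => hb.2 ⟨hb.1.1, h⟩)))
  rw [setIntegral_posPart_tailQuantile] at h3
  linarith

/-- Left of the quantile the cdf is below `1 - a`; without an atom it is continuous there, so the
bound passes to the limit. -/
lemma real_Ioi_tailQuantile (ha0 : 0 < a) (ha1 : a < 1) (h : μ {tailQuantile μ a} = 0) :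
    μ.real (Set.Ioi (tailQuantile μ a)) = a := by
  refine le_antisymm ((tailQuantile_le_iff ha0 ha1 _).1 le_rfl) ?_
  set x := tailQuantile μ a with hx
  have hcont : ContinuousAt (cdf μ) x := by
    rw [← continuousWithinAt_univ, ← Set.Iic_union_Ici, continuousWithinAt_union]
    refine ⟨?_, (cdf μ).right_continuous x⟩
    rw [← continuousWithinAt_Iio_iff_Iic, (cdf μ).mono.continuousWithinAt_Iio_iff_leftLim_eq]
    have h' : (cdf μ).measure {x} = 0 := by rwa [measure_cdf]
    rw [StieltjesFunction.measure_singleton, ENNReal.ofReal_eq_zero] at h'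
    exact le_antisymm ((cdf μ).mono.leftLim_le le_rfl) (by linarith)
  have hlt : ∀ y ∈ Set.Iio x, cdf μ y ≤ 1 - a := by
    intro y hy
    have := mt (tailQuantile_le_iff (μ := μ) ha0 ha1 y).2 (not_le.2 hy)
    rw [real_Ioi_eq_one_sub_cdf] at this
    linarith
  have := le_of_tendsto (hcont.tendsto.mono_left nhdsWithin_le_nhds)
    (eventually_nhdsWithin_of_forall hlt)
  rw [real_Ioi_eq_one_sub_cdf]
  linarith

end TailQuantile

end RecoveryRisk

namespace RecoveryRisk

/-! ### AV@R of a random variable: monotonicity, Lipschitz continuity, directional derivative. -/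

section AverageValueAtRisk

variable {Ω : Type*} [MeasurableSpace Ω] {P : Measure Ω}
  {X Y : Ω → ℝ} {a : ℝ}

lemma var_eq_tailQuantile (hX : AEMeasurable X P) (b : ℝ) :
    var P b X = tailQuantile (P.map fun ω => -X ω) b := by
  unfold var tailQuantile
  congr 1
  ext x
  simp only [Set.mem_ofPred_eq]
  rw [map_measureReal_apply_of_aemeasurable hX.fun_neg measurableSet_Ioi]
  have : {ω | X ω + x < 0} = (fun ω => -X ω) ⁻¹' Set.Ioi x := by
    ext ω
    simp only [Set.mem_ofPred_eq, Set.mem_preimage, Set.mem_Ioi]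
    constructor <;> intro h <;> linarith
  rw [this]

lemma integrable_id_map_neg (hX : Integrable X P) :
    Integrable id (P.map fun ω => -X ω) :=
  (integrable_map_measure aestronglyMeasurable_id hX.aemeasurable.fun_neg).2 hX.neg

lemma integral_posPart_map_neg (hX : Integrable X P) (x : ℝ) :
    ∫ t, max (t - x) 0 ∂(P.map fun ω => -X ω) = ∫ ω, max (-X ω - x) 0 ∂P :=
  integral_map hX.aemeasurable.fun_neg
    (by fun_prop : Continuous fun t : ℝ => max (t - x) 0).aestronglyMeasurable

variable [IsProbabilityMeasure P]

lemma isProbabilityMeasure_map_neg (hX : Integrable X P) :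
    IsProbabilityMeasure (P.map fun ω => -X ω) :=
  Measure.isProbabilityMeasure_map hX.aemeasurable.fun_neg

lemma integrable_shortfall (hX : Integrable X P) (x : ℝ) :
    Integrable (fun ω => max (-X ω - x) 0) P :=
  (hX.neg.sub (integrable_const x)).pos_part

/-- The Rockafellar–Uryasev bound. -/
lemma avar_le (hX : Integrable X P) (ha0 : 0 < a) (ha1 : a < 1) (x : ℝ) :
    avar P a X ≤ x + (1 / a) * ∫ ω, max (-X ω - x) 0 ∂P := by
  have := isProbabilityMeasure_map_neg hX
  have h := integral_tailQuantile_le (integrable_id_map_neg hX) ha0 ha1 x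
  rw [integral_posPart_map_neg hX] at h
  simp only [avar, var_eq_tailQuantile hX.aemeasurable]
  calc _ ≤ (1 / a) * (a * x + ∫ ω, max (-X ω - x) 0 ∂P) := by gcongr
    _ = _ := by field_simp

/-- The Rockafellar–Uryasev bound is attained at the Value at Risk. -/
lemma avar_eq (hX : Integrable X P) (ha0 : 0 < a) (ha1 : a < 1) :
    avar P a X = var P a X + (1 / a) * ∫ ω, max (-X ω - var P a X) 0 ∂P := by
  have := isProbabilityMeasure_map_neg hX
  have h := integral_tailQuantile_eq (integrable_id_map_neg hX) ha0 ha1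
  rw [integral_posPart_map_neg hX] at h
  simp only [avar, var_eq_tailQuantile hX.aemeasurable]
  rw [h]
  field_simp

/-- The V@R of `X` is optimal for `X` and merely admissible for `Y`, so shortfalls can be compared
at one common threshold. The same device gives `avar_le_add`. -/
lemma avar_anti (hX : Integrable X P) (hY : Integrable Y P) (ha0 : 0 < a) (ha1 : a < 1)
    (h : ∀ᵐ ω ∂P, X ω ≤ Y ω) : avar P a Y ≤ avar P a X := by
  refine (avar_le hY ha0 ha1 (var P a X)).trans ?_
  rw [avar_eq hX ha0 ha1]
  gcongr 1
  refine mul_le_mul_of_nonneg_left ?_ (by positivity)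
  refine integral_mono_ae (integrable_shortfall hY _) (integrable_shortfall hX _) ?_
  filter_upwards [h] with ω hω
  gcongr

lemma avar_le_add (hX : Integrable X P) (hY : Integrable Y P) (ha0 : 0 < a) (ha1 : a < 1) :
    avar P a Y ≤ avar P a X + (1 / a) * ∫ ω, |Y ω - X ω| ∂P := by
  refine (avar_le hY ha0 ha1 (var P a X)).trans ?_
  rw [avar_eq hX ha0 ha1, add_assoc, ← mul_add,
    ← integral_add (integrable_shortfall hX _) (g := fun ω => |Y ω - X ω|) (hY.sub hX).abs]
  gcongr 1
  refine mul_le_mul_of_nonneg_left ?_ (by positivity)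
  refine integral_mono (integrable_shortfall hY _)
    ((integrable_shortfall hX _).add (hY.sub hX).abs) fun ω => ?_
  have h1 := neg_abs_le (Y ω - X ω)
  have h2 := abs_nonneg (Y ω - X ω)
  exact max_le (by linarith [le_max_left (-X ω - var P a X) 0])
    (add_nonneg (le_max_right _ _) h2)

/-- Average Value at Risk is Lipschitz with constant `1 / a` in `L¹`. -/
lemma abs_avar_sub_avar_le (hX : Integrable X P) (hY : Integrable Y P) (ha0 : 0 < a)
    (ha1 : a < 1) : |avar P a Y - avar P a X| ≤ (1 / a) * ∫ ω, |Y ω - X ω| ∂P := by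
  have h1 := avar_le_add hX hY ha0 ha1
  have h2 := avar_le_add hY hX ha0 ha1
  simp only [abs_sub_comm (X _) (Y _)] at h2
  rw [abs_le]
  constructor <;> linarith

lemma continuous_avar_add_mul (hX : Integrable X P) (hY : Integrable Y P) (ha0 : 0 < a)
    (ha1 : a < 1) : Continuous fun h : ℝ => avar P a fun ω => X ω + h * Y ω := by
  have hint (h : ℝ) : Integrable (fun ω => X ω + h * Y ω) P := hX.add (hY.const_mul h)
  refine LipschitzWith.continuous (K := Real.toNNReal ((1 / a) * ∫ ω, |Y ω| ∂P))
    (LipschitzWith.of_dist_le_mul fun s t => ?_)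
  rw [Real.dist_eq, Real.dist_eq, Real.coe_toNNReal _ (by positivity)]
  refine (abs_avar_sub_avar_le (hint t) (hint s) ha0 ha1).trans_eq ?_
  have : ∀ ω, |X ω + s * Y ω - (X ω + t * Y ω)| = |s - t| * |Y ω| := fun ω => by
    rw [← abs_mul]; congr 1; ring
  simp only [this, integral_const_mul]
  ring

/-- The dual bound: losses averaged over an event of probability `a`. -/
lemma neg_setIntegral_le_avar (hX : Integrable X P) (ha0 : 0 < a) (ha1 : a < 1) {A : Set Ω}
    (hA : P.real A = a) : -((1 / a) * ∫ ω in A, X ω ∂P) ≤ avar P a X := by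
  rw [avar_eq hX ha0 ha1]
  set x := var P a X
  have h1 : ∫ ω in A, (-X ω - x) ∂P ≤ ∫ ω, max (-X ω - x) 0 ∂P :=
    (integral_mono (hX.neg.sub (integrable_const x)).integrableOn
      (integrable_shortfall hX x).integrableOn fun ω => le_max_left _ _).trans
    (setIntegral_le_integral (integrable_shortfall hX x)
      (Eventually.of_forall fun ω => le_max_right _ _))
  rw [integral_sub hX.fun_neg.integrableOn (integrable_const x).integrableOn, integral_neg,
    setIntegral_const, hA, smul_eq_mul] at h1
  have h2 : (1 / a) * (-∫ ω in A, X ω ∂P - a * x) ≤ (1 / a) * ∫ ω, max (-X ω - x) 0 ∂P := by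
    gcongr
  have h3 : (1 / a) * (-∫ ω in A, X ω ∂P - a * x) = -((1 / a) * ∫ ω in A, X ω ∂P) - x := by
    field_simp
  linarith

/-- This makes the tail event a competitor in the dual bound and gives the normalisation `1 / a` of
the conditional expectation. -/
lemma measureReal_le_neg_var (hX : Integrable X P) (ha0 : 0 < a) (ha1 : a < 1)
    (hatom : P {ω | X ω = -var P a X} = 0) : P.real {ω | X ω ≤ -var P a X} = a := by
  have := isProbabilityMeasure_map_neg hX
  have hv := var_eq_tailQuantile hX.aemeasurable a
  have h0 : (P.map fun ω => -X ω) {tailQuantile (P.map fun ω => -X ω) a} = 0 := by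
    rw [Measure.map_apply_of_aemeasurable hX.aemeasurable.fun_neg (measurableSet_singleton _),
      ← hv, ← hatom]
    congr 1
    ext ω
    simp only [Set.mem_preimage, Set.mem_singleton_iff, Set.mem_ofPred_eq]
    constructor <;> intro h <;> linarith
  have h1 := real_Ioi_tailQuantile ha0 ha1 h0
  rw [map_measureReal_apply_of_aemeasurable hX.aemeasurable.fun_neg measurableSet_Ioi, ← hv] at h1
  refine Eq.trans (measureReal_congr ?_) h1
  have hne : ∀ᵐ ω ∂P, X ω ≠ -var P a X := by
    rw [ae_iff]; simpa using hatom
  filter_upwards [hne] with ω hω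
  change (X ω ≤ -var P a X) = (var P a X < -X ω)
  refine propext ⟨fun h => ?_, fun h => by linarith⟩
  have := lt_of_le_of_ne h hω
  linarith

lemma hasDerivAt_of_squeeze {f g k : ℝ → ℝ} {c x : ℝ} (hf : HasDerivAt f c x)
    (hk : HasDerivAt k c x) (hfg : ∀ y, f y ≤ g y) (hgk : ∀ y, g y ≤ k y) (hfx : f x = g x)
    (hkx : g x = k x) : HasDerivAt g c x := by
  rw [hasDerivAt_iff_isLittleO] at *
  refine (Asymptotics.IsBigO.of_norm_le fun y => ?_).trans_isLittleO
    (hf.norm_left.add hk.norm_left)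
  have h1 := hfg y
  have h2 := hgk y
  simp only [Real.norm_eq_abs, hfx, ← hkx, smul_eq_mul] at *
  rw [abs_le]
  constructor
  · linarith [neg_abs_le (f y - g x - (y - x) * c), abs_nonneg (k y - g x - (y - x) * c)]
  · linarith [le_abs_self (k y - g x - (y - x) * c), abs_nonneg (f y - g x - (y - x) * c)]

lemma hasDerivAt_max_sub (s t x : ℝ) (h : s ≠ x) :
    HasDerivAt (fun y : ℝ => max (s + y * t - x) 0) (if x < s then t else 0) 0 := by
  have hlin : HasDerivAt (fun y : ℝ => s + y * t - x) t 0 := by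
    simpa using (((hasDerivAt_id (0 : ℝ)).mul_const t).const_add s).sub_const x
  have hc : Tendsto (fun y : ℝ => s + y * t - x) (𝓝 0) (𝓝 (s - x)) := by
    simpa using hlin.continuousAt.tendsto
  split_ifs with hxs
  · refine hlin.congr_of_eventuallyEq ?_
    filter_upwards [hc.eventually_const_lt (sub_pos.2 hxs)] with y hy
    exact max_eq_left hy.le
  · refine (hasDerivAt_const (0 : ℝ) (0 : ℝ)).congr_of_eventuallyEq ?_
    filter_upwards [hc.eventually_lt_const
      (sub_neg.2 (lt_of_le_of_ne (not_lt.1 hxs) h))] with y hy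
    exact max_eq_right hy.le

/-- The directional derivative of Average Value at Risk at a position without an atom at its
Value at Risk is the expected loss of the direction in the tail event. -/
theorem hasDerivAt_avar (hX : Integrable X P) (hY : Integrable Y P) (ha0 : 0 < a) (ha1 : a < 1)
    (hatom : P {ω | X ω = -var P a X} = 0) :
    HasDerivAt (fun h : ℝ => avar P a fun ω => X ω + h * Y ω)
      (-∫ ω, Y ω ∂(P[|{ω | X ω ≤ -var P a X}])) 0 := by
  set x := var P a X with hx
  set A := {ω | X ω ≤ -x} with hA
  have hPA : P.real A = a := measureReal_le_neg_var hX ha0 ha1 hatom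
  have hAm : NullMeasurableSet A P := nullMeasurableSet_le hX.aemeasurable aemeasurable_const
  have hint (h : ℝ) : Integrable (fun ω => X ω + h * Y ω) P := hX.add (hY.const_mul h)
  have hcond : -∫ ω, Y ω ∂(P[|A]) = -((1 / a) * ∫ ω in A, Y ω ∂P) := by
    rw [ProbabilityTheory.cond, integral_smul_measure, ENNReal.toReal_inv, ← measureReal_def,
      hPA, smul_eq_mul, one_div]
  have hne : ∀ᵐ ω ∂P, X ω ≠ -x := by
    rw [ae_iff]; simpa using hatom
  -- Differentiation under the integral: the integrand is Lipschitz in `h` with constant `|Y ω|`,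
  -- and the kink at `h = 0` is met only on the null set `X = -x`.
  have hderiv : HasDerivAt (fun h : ℝ => ∫ ω, max (-(X ω + h * Y ω) - x) 0 ∂P)
      (∫ ω, A.indicator (fun ω => -Y ω) ω ∂P) 0 := by
    refine (hasDerivAt_integral_of_dominated_loc_of_lip (bound := fun ω => |Y ω|) univ_mem
      (Eventually.of_forall fun h => (integrable_shortfall (hint h) x).aestronglyMeasurable)
      (integrable_shortfall (hint 0) x)
      (hY.fun_neg.aestronglyMeasurable.indicator₀ hAm) ?_ hY.abs ?_).2
    · refine Eventually.of_forall fun ω => ?_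
      refine LipschitzWith.lipschitzOnWith (LipschitzWith.of_dist_le_mul fun s t => ?_)
      rw [Real.dist_eq, Real.dist_eq, Real.coe_nnabs, abs_abs]
      refine (abs_max_sub_max_le_abs _ _ _).trans_eq ?_
      rw [← abs_mul, ← abs_neg]
      congr 1
      ring
    · filter_upwards [hne] with ω hω
      have h := hasDerivAt_max_sub (-X ω) (-Y ω) x fun h => hω (by linarith)
      have hfun : (fun y : ℝ => max (-X ω + y * -Y ω - x) 0)
          = fun y : ℝ => max (-(X ω + y * Y ω) - x) 0 := by
        funext y; congr 1; ring
      rw [hfun] at h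
      have hval : A.indicator (fun ω => -Y ω) ω = if x < -X ω then -Y ω else 0 := by
        rw [Set.indicator_apply]
        refine if_congr (show X ω ≤ -x ↔ x < -X ω from ⟨fun h => ?_, fun h => by linarith⟩) rfl rfl
        have := lt_of_le_of_ne h hω
        linarith
      rwa [hval]
  -- Upper barrier: the threshold stays at `x`. Lower barrier, next: the event stays at `A`.
  have hupper : HasDerivAt
      (fun h : ℝ => x + (1 / a) * ∫ ω, max (-(X ω + h * Y ω) - x) 0 ∂P)
      (-((1 / a) * ∫ ω in A, Y ω ∂P)) 0 := by
    rw [integral_indicator₀ hAm, integral_neg] at hderiv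
    simpa only [mul_neg] using (hderiv.const_mul (1 / a)).const_add x
  have hlower : HasDerivAt (fun h : ℝ => -((1 / a) * ∫ ω in A, (X ω + h * Y ω) ∂P))
      (-((1 / a) * ∫ ω in A, Y ω ∂P)) 0 := by
    have hlin (h : ℝ) : ∫ ω in A, (X ω + h * Y ω) ∂P
        = (∫ ω in A, X ω ∂P) + h * ∫ ω in A, Y ω ∂P := by
      rw [integral_add hX.integrableOn (hY.const_mul h).integrableOn, integral_const_mul]
    simp only [hlin]
    simpa using ((((hasDerivAt_id (0 : ℝ)).mul_const (∫ ω in A, Y ω ∂P)).const_add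
      (∫ ω in A, X ω ∂P)).const_mul (1 / a)).fun_neg
  rw [hcond]
  refine hasDerivAt_of_squeeze hlower hupper
    (fun h => neg_setIntegral_le_avar (hint h) ha0 ha1 hPA)
    (fun h => avar_le (hint h) ha0 ha1 x) ?_ ?_
  · simp only [zero_mul, add_zero]
    rw [avar_eq hX ha0 ha1]
    have hmax : ∫ ω, max (-X ω - x) 0 ∂P = ∫ ω in A, (-X ω - x) ∂P := by
      rw [← integral_indicator₀ hAm]
      congr 1
      funext ω
      by_cases hω : X ω ≤ -x
      · rw [Set.indicator_of_mem (show ω ∈ A from hω)]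
        exact max_eq_left (by linarith)
      · rw [Set.indicator_of_notMem (show ω ∉ A from hω)]
        exact max_eq_right (by linarith)
    rw [hmax, integral_sub hX.fun_neg.integrableOn (integrable_const x).integrableOn, integral_neg,
      setIntegral_const, hPA, smul_eq_mul]
    field_simp
    ring
  · simp only [zero_mul, add_zero]
    exact avar_eq hX ha0 ha1

end AverageValueAtRisk

end RecoveryRisk

namespace RecoveryRisk

/-! ### Step level functions: the supremum as a maximum over nodes. -/

namespace IsStepLevel

variable {n : ℕ} {α : Fin (n + 1) → ℝ} {r : Fin (n + 2) → ℝ} {γ : Set.Icc (0 : ℝ) 1 → ℝ}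

lemma level_pos' (hγ : IsStepLevel α r γ) (k : Fin (n + 1)) : 0 < α k :=
  hγ.level_pos.trans_le (hγ.level_strictMono.monotone (Fin.zero_le k))

lemma level_lt_one' (hγ : IsStepLevel α r γ) (k : Fin (n + 1)) : α k < 1 :=
  (hγ.level_strictMono.monotone (Fin.le_last k)).trans_lt hγ.level_lt_one

lemma node_nonneg (hγ : IsStepLevel α r γ) (i : Fin (n + 2)) : 0 ≤ r i :=
  hγ.node_zero ▸ hγ.node_strictMono.monotone (Fin.zero_le i)

lemma node_le_one (hγ : IsStepLevel α r γ) (i : Fin (n + 2)) : r i ≤ 1 :=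
  hγ.node_last ▸ hγ.node_strictMono.monotone (Fin.le_last i)

lemma exists_step (hγ : IsStepLevel α r γ) {l : ℝ} (hl : 0 ≤ l) (i : Fin (n + 2))
    (hi : l < r i) : ∃ k : Fin (n + 1), r k.castSucc ≤ l ∧ l < r k.succ := by
  induction i using Fin.induction with
  | zero => rw [hγ.node_zero] at hi; exact absurd hi (not_lt.2 hl)
  | succ k ih =>
    rcases lt_or_ge l (r k.castSucc) with h | h
    · exact ih h
    · exact ⟨k, h, hi⟩

lemma exists_level_eq (hγ : IsStepLevel α r γ) (l : Set.Icc (0 : ℝ) 1) :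
    ∃ k : Fin (n + 1), γ l = α k ∧ (l : ℝ) ≤ r k.succ := by
  rcases l.2.2.lt_or_eq with h | h
  · obtain ⟨k, h1, h2⟩ := hγ.exists_step l.2.1 (Fin.last (n + 1)) (by rwa [hγ.node_last])
    exact ⟨k, hγ.eq_level k l h1 h2, h2.le⟩
  · exact ⟨Fin.last n, hγ.eq_level_one l h, by rw [Fin.succ_last, hγ.node_last]; exact l.2.2⟩

variable {Ω : Type*} [MeasurableSpace Ω] {P : Measure Ω} [IsProbabilityMeasure P] {X Y : Ω → ℝ}

lemma reavar_le (hγ : IsStepLevel α r γ) (hX : Integrable X P) (hY : Integrable Y P)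
    (hY0 : ∀ᵐ ω ∂P, 0 ≤ Y ω) {c : ℝ}
    (hc : ∀ k, avar P (α k) (fun ω => X ω + (1 - r k.succ) * Y ω) ≤ c) :
    reavar P γ X Y ≤ c := by
  refine iSup_le fun l => EReal.coe_le_coe_iff.2 ?_
  obtain ⟨k, hk, hl⟩ := hγ.exists_level_eq l
  rw [hk]
  refine (avar_anti (hX.add (hY.const_mul _)) (hX.add (hY.const_mul _)) (hγ.level_pos' k)
    (hγ.level_lt_one' k) ?_).trans (hc k)
  filter_upwards [hY0] with ω hω
  change X ω + (1 - r k.succ) * Y ω ≤ X ω + (1 - (l : ℝ)) * Y ω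
  gcongr

/-- At an interior node `r k.succ` the level has already jumped to the next one, so the value with
level `α k` is reached only as a limit from the left. -/
lemma le_reavar (hγ : IsStepLevel α r γ) (hX : Integrable X P) (hY : Integrable Y P)
    (k : Fin (n + 1)) :
    (avar P (α k) (fun ω => X ω + (1 - r k.succ) * Y ω) : EReal) ≤ reavar P γ X Y := by
  have hlt : r k.castSucc < r k.succ := hγ.node_strictMono k.castSucc_lt_succ
  have hcont : Continuous fun l : ℝ =>
      ((avar P (α k) (fun ω => X ω + (1 - l) * Y ω) : ℝ) : EReal) :=
    continuous_coe_real_ereal.comp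
      ((continuous_avar_add_mul hX hY (hγ.level_pos' k) (hγ.level_lt_one' k)).comp
        (continuous_const.sub continuous_id))
  refine le_of_tendsto (hcont.continuousAt.tendsto.mono_left
    (nhdsWithin_le_nhds (s := Set.Iio (r k.succ)))) ?_
  filter_upwards [Ico_mem_nhdsLT hlt] with l hl
  have hmem : l ∈ Set.Icc (0 : ℝ) 1 :=
    ⟨(hγ.node_nonneg _).trans hl.1, hl.2.le.trans (hγ.node_le_one _)⟩
  rw [← hγ.eq_level k ⟨l, hmem⟩ hl.1 hl.2]
  exact le_iSup (fun l : Set.Icc (0 : ℝ) 1 =>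
    ((avar P (γ l) (fun ω => X ω + (1 - (l : ℝ)) * Y ω) : ℝ) : EReal)) ⟨l, hmem⟩

/-- For a step level function the recovery risk measure is attained just below the node `j`
whenever the Average Value at Risk at that node dominates those at the other nodes. -/
lemma reavar_eq (hγ : IsStepLevel α r γ) (hX : Integrable X P) (hY : Integrable Y P)
    (hY0 : ∀ᵐ ω ∂P, 0 ≤ Y ω) {j : Fin (n + 1)}
    (hj : ∀ k, avar P (α k) (fun ω => X ω + (1 - r k.succ) * Y ω)
      ≤ avar P (α j) (fun ω => X ω + (1 - r j.succ) * Y ω)) :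
    reavar P γ X Y = avar P (α j) (fun ω => X ω + (1 - r j.succ) * Y ω) :=
  le_antisymm (hγ.reavar_le hX hY hY0 hj) (hγ.le_reavar hX hY j)

end IsStepLevel

/-! ### Absence of atoms and cash additivity. -/

/-- Given the other coordinates, the event fixes the value of `X 0`, which is a null event because
the conditional law has a density; then disintegrate. -/
lemma AssumptionSWith.measure_sum_eq_zero {Ω : Type*} [MeasurableSpace Ω] {P : Measure Ω}
    [IsFiniteMeasure P] {m : ℕ} {a : ℝ} {X : Fin (m + 1) → Ω → ℝ} {φ : ℝ → (Fin m → ℝ) → ℝ}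
    (h : AssumptionSWith P a X φ) (x : ℝ) : P {ω | ∑ i, X i ω = x} = 0 := by
  have h0 : AEMeasurable (X 0) P := (h.integrable 0).aemeasurable
  have hY : AEMeasurable (fun ω (i : Fin m) => X i.succ ω) P :=
    aemeasurable_pi_lambda _ fun i => (h.integrable i.succ).aemeasurable
  have hs : MeasurableSet {p : (Fin m → ℝ) × ℝ | p.2 + ∑ i, p.1 i = x} :=
    measurableSet_eq_fun (by fun_prop) measurable_const
  have hmap : P {ω | ∑ i, X i ω = x}
      = P.map (fun ω => ((fun i : Fin m => X i.succ ω), X 0 ω)) {p | p.2 + ∑ i, p.1 i = x} := by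
    rw [Measure.map_apply_of_aemeasurable (hY.prodMk h0) hs]
    simp only [Fin.sum_univ_succ, Set.preimage_ofPred_eq]
  rw [hmap, ← compProd_map_condDistrib h0, Measure.compProd_apply hs, lintegral_eq_zero_iff'
    (Kernel.measurable_kernel_prodMk_left hs).aemeasurable]
  filter_upwards [h.cond_density] with y hy
  have hset : Prod.mk y ⁻¹' {p : (Fin m → ℝ) × ℝ | p.2 + ∑ i, p.1 i = x} = {x - ∑ i, y i} := by
    ext t
    simp [eq_sub_iff_add_eq]
  rw [hy, hset]
  exact withDensity_absolutelyContinuous _ _ Real.volume_singleton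

/-- Cash additivity of Value at Risk. -/
lemma var_add_const {Ω : Type*} [MeasurableSpace Ω] (P : Measure Ω) [IsProbabilityMeasure P]
    {X : Ω → ℝ} (hX : AEMeasurable X P) {a : ℝ} (ha0 : 0 < a) (ha1 : a < 1) (c : ℝ) :
    var P a (fun ω => X ω + c) = var P a X - c := by
  have hset (Y : Ω → ℝ) (hY : AEMeasurable Y P) (x : ℝ) :
      var P a Y ≤ x ↔ P.real {ω | Y ω + x < 0} ≤ a := by
    have := Measure.isProbabilityMeasure_map (μ := P) hY.fun_neg
    rw [var_eq_tailQuantile hY, tailQuantile_le_iff ha0 ha1,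
      map_measureReal_apply_of_aemeasurable hY.fun_neg measurableSet_Ioi]
    have : (fun ω => -Y ω) ⁻¹' Set.Ioi x = {ω | Y ω + x < 0} := by
      ext ω
      simp only [Set.mem_ofPred_eq, Set.mem_preimage, Set.mem_Ioi]
      constructor <;> intro h <;> linarith
    rw [this]
  refine eq_of_forall_ge_iff fun x => ?_
  rw [hset _ (hX.add_const c), sub_le_iff_le_add, hset X hX]
  simp only [add_assoc, add_comm c]

end RecoveryRisk

/-! ### The Euler allocation. -/

open RecoveryRisk in
/-- `N = m + 1` subentities with net asset values `E0 i` (deterministic, today) and `E1 i`,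
and liabilities `L1 i`; the variation of net asset value of subentity `i` is `E1 i - E0 i`. -/
theorem proposition5p2 {Ω : Type*} [MeasurableSpace Ω] (P : Measure Ω) [IsProbabilityMeasure P]
    (m n : ℕ) (E0 : Fin (m + 1) → ℝ) (E1 L1 : Fin (m + 1) → Ω → ℝ)
    (hE : ∀ i, Integrable (E1 i) P) (hL : ∀ i, Integrable (L1 i) P)
    (hL_nonneg : ∀ i, ∀ᵐ ω ∂P, 0 ≤ L1 i ω)
    (α : Fin (n + 1) → ℝ) (r : Fin (n + 2) → ℝ) (γ : Set.Icc (0 : ℝ) 1 → ℝ)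
    (hγ : RecoveryRisk.IsStepLevel α r γ)
    (j : Fin (n + 1))
    (hj : ∀ k, k ≠ j →
      RecoveryRisk.avar P (α k)
          (fun ω => (∑ i, (E1 i ω - E0 i)) + (1 - r k.succ) * ∑ i, L1 i ω)
        < RecoveryRisk.avar P (α j)
          (fun ω => (∑ i, (E1 i ω - E0 i)) + (1 - r j.succ) * ∑ i, L1 i ω))
    (hS : RecoveryRisk.AssumptionS P (α j)
      (fun i ω => -((E1 i ω - E0 i) + (1 - r j.succ) * L1 i ω))) :
    RecoveryRisk.IsEulerAllocation (RecoveryRisk.reavar P γ)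
      (fun i ω => E1 i ω - E0 i) L1
      (fun i => -∫ ω, ((E1 i ω - E0 i) + (1 - r j.succ) * L1 i ω)
        ∂(P[|{ω | (∑ k, E1 k ω) + (1 - r j.succ) * ∑ k, L1 k ω
              ≤ -RecoveryRisk.var P (α j)
                  (fun ω => (∑ k, E1 k ω) + (1 - r j.succ) * ∑ k, L1 k ω)}])) := by
  intro i
  set D : Fin (m + 1) → Ω → ℝ := fun i ω => E1 i ω - E0 i with hD
  have hDint (k : Fin (m + 1)) : Integrable (D k) P := (hE k).sub (integrable_const _)
  set X : Ω → ℝ := fun ω => ∑ k, D k ω with hX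
  set Y : Ω → ℝ := fun ω => ∑ k, L1 k ω with hY
  have hXint : Integrable X P := integrable_finsetSum _ fun k _ => hDint k
  have hYint : Integrable Y P := integrable_finsetSum _ fun k _ => hL k
  have hpos := hγ.level_pos'
  have hlt := hγ.level_lt_one'
  have hXh (h : ℝ) : Integrable (fun ω => X ω + h * D i ω) P := hXint.add ((hDint i).const_mul h)
  have hYh (h : ℝ) : Integrable (fun ω => Y ω + h * L1 i ω) P := hYint.add ((hL i).const_mul h)
  let S (k : Fin (n + 1)) : Ω → ℝ := fun ω => X ω + (1 - r k.succ) * Y ω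
  let Z (k : Fin (n + 1)) : Ω → ℝ := fun ω => D i ω + (1 - r k.succ) * L1 i ω
  have hSint (k) : Integrable (S k) P := hXint.add (hYint.const_mul _)
  have hZint (k) : Integrable (Z k) P := (hDint i).add ((hL i).const_mul _)
  have hsplit (k : Fin (n + 1)) (h : ℝ) :
      (fun ω => (X ω + h * D i ω) + (1 - r k.succ) * (Y ω + h * L1 i ω))
        = fun ω => S k ω + h * Z k ω := by
    funext ω; simp only [S, Z]; ring
  -- The perturbed liabilities must stay nonnegative; for `h > -1` they dominate `(1 + h) * L1 i ≥
  -- 0`, because `L1 i` is a summand of `Y`.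
  have hYnonneg : ∀ᶠ h : ℝ in 𝓝 0, ∀ᵐ ω ∂P, 0 ≤ Y ω + h * L1 i ω := by
    filter_upwards [Ioi_mem_nhds (show (-1 : ℝ) < 0 by norm_num)] with h hh
    filter_upwards [ae_all_iff.2 hL_nonneg] with ω hω
    have h1 : L1 i ω ≤ Y ω :=
      Finset.single_le_sum (f := fun k => L1 k ω) (fun k _ => hω k) (Finset.mem_univ i)
    nlinarith [hω i, Set.mem_Ioi.1 hh]
  have hdom : ∀ᶠ h : ℝ in 𝓝 0, ∀ k, avar P (α k) (fun ω => S k ω + h * Z k ω)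
      ≤ avar P (α j) (fun ω => S j ω + h * Z j ω) := by
    refine eventually_all.2 fun k => ?_
    rcases eq_or_ne k j with rfl | hkj
    · exact Eventually.of_forall fun h => le_rfl
    · have hk := (continuous_avar_add_mul (hSint k) (hZint k) (hpos k) (hlt k)).tendsto 0
      have hj' := (continuous_avar_add_mul (hSint j) (hZint j) (hpos j) (hlt j)).tendsto 0
      refine (hk.eventually_lt hj' ?_).mono fun h hh => hh.le
      simpa only [zero_mul, add_zero] using hj k hkj
  have hev : ∀ᶠ h : ℝ in 𝓝 0,
      reavar P γ (fun ω => X ω + h * D i ω) (fun ω => Y ω + h * L1 i ω)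
        = (avar P (α j) (fun ω => S j ω + h * Z j ω) : ℝ) := by
    filter_upwards [hYnonneg, hdom] with h h1 h2
    rw [hγ.reavar_eq (hXh h) (hYh h) h1 (j := j) (by simpa only [hsplit] using h2), hsplit]
  refine ⟨hev.mono fun h hh => ?_, ?_⟩
  · rw [hh]
    exact ⟨EReal.coe_ne_top _, EReal.coe_ne_bot _⟩
  obtain ⟨φ, hφ⟩ := hS
  -- `-S j` is the sum of the variables in Assumption (S).
  have hatom : P {ω | S j ω = -var P (α j) (S j)} = 0 := by
    rw [← hφ.measure_sum_eq_zero (var P (α j) (S j))]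
    congr 1
    ext ω
    simp only [Set.mem_ofPred_eq, S, X, Y, Finset.sum_neg_distrib, Finset.sum_add_distrib,
      ← Finset.mul_sum, D]
    rw [neg_eq_iff_eq_neg]
  set T : Ω → ℝ := fun ω => (∑ k, E1 k ω) + (1 - r j.succ) * ∑ k, L1 k ω with hT
  have hST : S j = fun ω => T ω + -∑ k, E0 k := by
    funext ω
    simp only [S, X, Y, D, T, Finset.sum_sub_distrib]
    ring
  have hTint : Integrable T P :=
    (integrable_finsetSum _ fun k _ => hE k).add (hYint.const_mul _)
  -- Subtracting the constant `∑ k, E0 k` shifts both sides of the inequality equally.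
  have hset : {ω | T ω ≤ -var P (α j) T} = {ω | S j ω ≤ -var P (α j) (S j)} := by
    ext ω
    simp only [hST, var_add_const P hTint.aemeasurable (hpos j) (hlt j), Set.mem_ofPred_eq]
    constructor <;> intro h <;> linarith
  rw [hset]
  refine (hasDerivAt_avar (hSint j) (hZint j) (hpos j) (hlt j) hatom).congr_of_eventuallyEq ?_
  filter_upwards [hev] with h hh
  rw [hh, EReal.toReal_coe]
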